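/- **Proposition 4.3 ($\partial_{E_2}$ of the MacMahon series).** Work with formal power series in $q$ over $\mathbb{C}$. For $k\ge 1$ let $$E_{2k}(q)=1-\frac{4k}{B_{2k}}\sum_{n\ge1}\sigma_{2k-1}(n)q^n ,\qquad \sigma_m(n)=\sum_{d\mid n}d^m,$$ where $B_{2k}$ are the Bernoulli numbers, and for $t\ge 0$ let $$\mathcal U_{2t}(q)=\sum_{1\le k_1<\cdots<k_t}\frac{q^{k_1+\cdots+k_t}}{(1-q^{k_1})^2\cdots(1-q^{k_t})^2},\qquad \mathcal U^{\star}_{2t}(q)=\sum_{1\le k_1\le\cdots\le k_t}\frac{q^{k_1+\cdots+k_t}}{(1-q^{k_1})^2\cdots(1-q^{k_t})^2},$$ so that $\mathcal U_0=\mathcal U_0^\star=1$. The series $E_2,E_4,E_6$ are algebraically independent over $\mathbb{C}$, so that the ring $\mathbb{C}[E_2,E_4,E_6]$ is a polynomial ring in these three generators and carries the partial derivative $\partial_{E_2}$ with respect to $E_2$ (holding $E_4,E_6$ fixed). All $\mathcal U_{2t}$ and $\mathcal U_{2t}^\star$ lie in $\mathbb{C}[E_2,E_4,E_6]$, and for every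 integer $t\ge0$ $$\partial_{E_2}\,\mathcal U_{2t}=-\frac1{12}\sum_{j=1}^{t}\frac{\mathcal U_{2t-2j}}{j^2\binom{2j}{j}} \qquad\text{and}\qquad \partial_{E_2}\,\mathcal U^{\star}_{2t}=\frac1{12}\sum_{j=1}^{t}\frac{(-1)^j\,\mathcal U^{\star}_{2t-2j}}{j^2\binom{2j}{j}} .$$ -/

import Mathlib

namespace MacMahonQM

open scoped PowerSeries ArithmeticFunction.sigma

noncomputable section

/-- The normalized Eisenstein series `E_{2k}(q) = 1 - (4k / B_{2k}) ∑_{n ≥ 1} σ_{2k-1}(n) qⁿ`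
(for `k ≥ 1`), as a formal power series in `q`; recall that `σ j 0 = 0` in Mathlib. -/
def eisensteinSeries (k : ℕ) : ℂ⟦X⟧ :=
  1 - ((4 * (k : ℂ)) / ((bernoulli (2 * k) : ℚ) : ℂ)) •
    PowerSeries.mk (fun n => ((σ (2 * k - 1) n : ℕ) : ℂ))

/-- The three generators `E_2, E_4, E_6`. -/
def gens : Fin 3 → ℂ⟦X⟧ :=
  ![eisensteinSeries 1, eisensteinSeries 2, eisensteinSeries 3]

/-- The ring `ℂ[E_2, E_4, E_6]` of quasimodular forms of level one, inside `ℂ⟦q⟧`. -/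
abbrev quasimodularRing : Subalgebra ℂ ℂ⟦X⟧ :=
  Algebra.adjoin ℂ (Set.range gens)

/-- The operator `∂/∂E_2` on `ℂ[E_2, E_4, E_6]`: identify this ring with the polynomial ring in
three variables (possible as `E_2, E_4, E_6` are algebraically independent, which is what `h` says)
and take the partial derivative with respect to the variable that corresponds to `E_2`. -/
def partialE2 (h : AlgebraicIndependent ℂ gens) (f : quasimodularRing) : quasimodularRing :=
  h.aevalEquiv (MvPolynomial.pderiv 0 (h.aevalEquiv.symm f))

/-- The summand `q^{k_1 + ⋯ + k_t} / ((1 - q^{k_1})² ⋯ (1 - q^{k_t})²)` as a formal power series. -/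
def summand {t : ℕ} (k : Fin t → ℕ+) : ℂ⟦X⟧ :=
  ∏ i, ((PowerSeries.X : ℂ⟦X⟧) ^ (k i : ℕ) * ((1 - (PowerSeries.X : ℂ⟦X⟧) ^ (k i : ℕ)) ^ 2)⁻¹)

open scoped PowerSeries.WithPiTopology in
/-- MacMahon's series `𝒰_{2t}(q)`: the sum over `1 ≤ k_1 < ⋯ < k_t`. -/
def macMahonU (t : ℕ) : ℂ⟦X⟧ :=
  ∑' k : {k : Fin t → ℕ+ // StrictMono k}, summand k.1

open scoped PowerSeries.WithPiTopology in
/-- The companion series `𝒰⋆_{2t}(q)`: the sum over `1 ≤ k_1 ≤ ⋯ ≤ k_t`. -/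
def macMahonUStar (t : ℕ) : ℂ⟦X⟧ :=
  ∑' k : {k : Fin t → ℕ+ // Monotone k}, summand k.1

theorem coeff_summand_eq_zero {t : ℕ} (k : Fin t → ℕ+) (n : ℕ) (i : Fin t) (hi : n < (k i : ℕ)) :
    PowerSeries.coeff n (summand k) = 0 := by
  have hd : (PowerSeries.X : ℂ⟦X⟧) ^ (k i : ℕ) ∣ summand k :=
    (Dvd.intro _ rfl).trans (Finset.dvd_prod_of_mem
      (fun i => (PowerSeries.X : ℂ⟦X⟧) ^ (k i : ℕ) *
        ((1 - (PowerSeries.X : ℂ⟦X⟧) ^ (k i : ℕ)) ^ 2)⁻¹) (Finset.mem_univ i))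
  exact PowerSeries.X_pow_dvd_iff.1 hd n hi

open scoped PowerSeries.WithPiTopology in
/-- The sums that define `macMahonU` and `macMahonUStar` converge. -/
theorem summable_summand (t : ℕ) (p : (Fin t → ℕ+) → Prop) :
    Summable (fun k : {k : Fin t → ℕ+ // p k} => summand k.1) := by
  rw [PowerSeries.WithPiTopology.summable_iff_summable_coeff]
  intro n
  apply summable_of_hasFiniteSupport
  have hf : (Set.pi Set.univ (fun _ : Fin t => {m : ℕ+ | (m : ℕ) ≤ n})).Finite := by
    refine Set.Finite.pi' (fun _ => ?_) |>.subset (fun k hk i => hk i (Set.mem_univ i))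
    exact (Set.finite_Iic n).preimage PNat.coe_injective.injOn
  refine (hf.preimage Subtype.val_injective.injOn).subset ?_
  intro k hk i _
  by_contra hlt
  exact hk (coeff_summand_eq_zero k.1 n i (not_le.1 hlt))

end

end MacMahonQM

namespace MacMahonQM

open scoped PowerSeries ArithmeticFunction.sigma MatrixGroups
open UpperHalfPlane ModularForm EisensteinSeries

noncomputable section

local notation "𝕢" => Function.Periodic.qParam

/-! The series `𝒰_{2t}` and `𝒰⋆_{2t}` are the elementary and complete homogeneous symmetric
functions of `x_k = q^k/(1-q^k)²`, so Newton's identities express them through the power sums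
`p_{m+1} = ∑ x_k^{m+1}`. The coefficient of `qⁿ` in `p_{m+1}` is the sum over `d ∣ n` of `C(d+m,
2m+1)`, an odd polynomial in `d`. Hence `p_{m+1}` is a combination of the series `∑ σ_{2j+1}(n) qⁿ`.
For `j ≥ 1` these lie in `ℂ[E_4, E_6]` (`qExpansion_mem_modularRing`), so `∂/∂E_2` sees only the
`σ_1` term and `∂p_{m+1}` is an explicit constant (`isPartialE2_powerSum`).

With generating series in a variable `T`, Newton's identities read `U' = U·A`. If `B' = ∂A` and
`B(0) = 0`, then `∂U = U·B`; its coefficients are the claimed formulas (`isPartialE2_of_newton`).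

Algebraic independence (`algebraicIndependent_gens`) comes from modularity: the non-modular term of
`E_2` lets the first argument of a relation vary freely, the weights let the other two be rescaled,
and `E_4³/E_6²` is transcendental. -/

theorem bernoulli_two_mul_ne_zero (k : ℕ) : bernoulli (2 * k) ≠ 0 := by
  rcases eq_or_ne k 0 with rfl | hk
  · simp
  intro h
  have h1 := riemannZeta_two_mul_nat hk
  have h2 : riemannZeta (2 * k) ≠ 0 := by
    apply riemannZeta_ne_zero_of_one_le_re
    have : (1 : ℝ) ≤ k := by exact_mod_cast Nat.one_le_iff_ne_zero.2 hk
    simp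
    linarith
  rw [h] at h1
  simp [h1] at h2

/-! ### Eisenstein series as convergent q-expansions -/

theorem coeff_eisensteinSeries (k n : ℕ) : (eisensteinSeries k).coeff n =
    if n = 0 then 1 else -((4 * (k : ℂ)) / ((bernoulli (2 * k) : ℚ) : ℂ)) * σ (2 * k - 1) n := by
  rcases eq_or_ne n 0 with rfl | h <;>
  simp [eisensteinSeries, PowerSeries.coeff_one, *]

theorem eisensteinSeries_eq_qExpansion {k : ℕ} (hk : 3 ≤ 2 * k) :
    eisensteinSeries k = qExpansion 1 (E hk) := by
  ext n
  rw [coeff_eisensteinSeries, E_qExpansion_coeff hk (even_two_mul k)]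
  push_cast
  ring_nf

theorem gens_zero : gens 0 = eisensteinSeries 1 := rfl

theorem gens_one : gens 1 = qExpansion 1 E₄ := eisensteinSeries_eq_qExpansion (k := 2) _

theorem gens_two : gens 2 = qExpansion 1 E₆ := eisensteinSeries_eq_qExpansion (k := 3) _

theorem hasSum_gens_zero (τ : ℍ) : HasSum (fun n => (gens 0).coeff n * 𝕢 1 τ ^ n) (E2 τ) := by
  have h := hasSum_qExpansion_E2 (z := τ)
  convert h using 2 with n
  · rw [gens_zero, coeff_eisensteinSeries, smul_eq_mul]
    congr 1
    · norm_num [bernoulli_two]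
    · simp [Function.Periodic.qParam]

theorem hasSum_gens_one (τ : ℍ) : HasSum (fun n => (gens 1).coeff n * 𝕢 1 τ ^ n) (E₄ τ) := by
  rw [gens_one]
  have : Fact (IsCusp OnePoint.infty 𝒮ℒ) :=
    ⟨Subgroup.isCusp_of_mem_strictPeriods one_pos one_mem_strictPeriods_SL⟩
  exact ModularForm.hasSum_qExpansion E₄ one_pos one_mem_strictPeriods_SL τ

theorem hasSum_gens_two (τ : ℍ) : HasSum (fun n => (gens 2).coeff n * 𝕢 1 τ ^ n) (E₆ τ) := by
  rw [gens_two]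
  have : Fact (IsCusp OnePoint.infty 𝒮ℒ) :=
    ⟨Subgroup.isCusp_of_mem_strictPeriods one_pos one_mem_strictPeriods_SL⟩
  exact ModularForm.hasSum_qExpansion E₆ one_pos one_mem_strictPeriods_SL τ

/-! ### Algebraic independence of `E_2, E_4, E_6` -/

theorem hasSum_coeff_mul {F G : ℂ⟦X⟧} {q a b : ℂ} (hF : HasSum (fun n => F.coeff n * q ^ n) a)
    (hG : HasSum (fun n => G.coeff n * q ^ n) b) :
    HasSum (fun n => (F * G).coeff n * q ^ n) (a * b) := by
  have key : (fun n => (F * G).coeff n * q ^ n) = fun n => ∑ kl ∈ Finset.HasAntidiagonal.antidiagonal n,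
      (F.coeff kl.1 * q ^ kl.1) * (G.coeff kl.2 * q ^ kl.2) := by
    ext n
    rw [PowerSeries.coeff_mul, Finset.sum_mul]
    refine Finset.sum_congr rfl fun x hx => ?_
    rw [← Finset.HasAntidiagonal.mem_antidiagonal.1 hx, pow_add]
    ring
  have h1 := summable_norm_sum_mul_antidiagonal_of_summable_norm hF.summable.norm hG.summable.norm
  rw [key, ← hF.tsum_eq, ← hG.tsum_eq,
    tsum_mul_tsum_eq_tsum_sum_antidiagonal_of_summable_norm hF.summable.norm hG.summable.norm]
  exact h1.of_norm.hasSum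

theorem hasSum_coeff_C (c q : ℂ) : HasSum (fun n => (PowerSeries.C c).coeff n * q ^ n) c := by
  convert hasSum_single (f := fun n => (PowerSeries.C c).coeff n * q ^ n) 0 ?_ using 1
  · simp
  · intro n hn
    simp [PowerSeries.coeff_C, hn]

theorem hasSum_coeff_aeval {ι : Type*} {F : ι → ℂ⟦X⟧} {v : ι → ℂ} {q : ℂ}
    (h : ∀ i, HasSum (fun n => (F i).coeff n * q ^ n) (v i)) (P : MvPolynomial ι ℂ) :
    HasSum (fun n => (MvPolynomial.aeval F P).coeff n * q ^ n) (MvPolynomial.aeval v P) := by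
  induction P using MvPolynomial.induction_on with
  | C a =>
    simpa [PowerSeries.algebraMap_apply] using hasSum_coeff_C a q
  | add P Q hP hQ => simpa [add_mul] using hP.add hQ
  | mul_X P i hP => simpa using hasSum_coeff_mul hP (h i)

theorem eq_zero_of_hasSum_zero {F : ℂ⟦X⟧}
    (h : ∀ τ : ℍ, HasSum (fun n => F.coeff n * 𝕢 1 τ ^ n) 0) : F = 0 := by
  ext n
  have := ModularFormClass.qExpansion_coeff_unique (f := (0 : ModularForm 𝒮ℒ 0)) (k := 0)
    (c := fun n => F.coeff n) one_pos one_mem_strictPeriods_SL (by simpa using h) n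
  rw [this, FunLike.coe_zero, qExpansion_zero, map_zero]

/-- The constant in the transformation law of `E2`. -/
def anomaly : ℂ := (1 / (2 * riemannZeta 2)) * (2 * Real.pi * Complex.I)

theorem anomaly_ne_zero : anomaly ≠ 0 := by
  simp [anomaly, riemannZeta_two, Real.pi_ne_zero]

theorem E2_smul (γ : SL(2, ℤ)) (τ : ℍ) :
    E2 (γ • τ) = denom γ τ ^ 2 * E2 τ - anomaly * (γ 1 0) * denom γ τ := by
  have h := congrFun (E2_slash_action γ) τ
  have hd := denom_ne_zero γ τ
  rw [SL_slash_apply] at h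
  simp only [Pi.sub_apply, Pi.smul_apply, smul_eq_mul, D2] at h
  rw [zpow_neg, zpow_ofNat] at h
  rw [anomaly]
  field_simp at h ⊢
  linear_combination h

theorem levelOne_smul {k : ℕ} (f : ModularForm 𝒮ℒ k) (γ : SL(2, ℤ)) (τ : ℍ) :
    f (γ • τ) = denom γ τ ^ k * f τ := by
  have h := congrFun (SlashInvariantFormClass.slash_action_eq f γ ⟨γ, rfl⟩) τ
  have hd := denom_ne_zero γ τ
  rw [← SL_slash, SL_slash_apply, zpow_neg, zpow_natCast] at h
  field_simp at h
  linear_combination h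

/-- Along a polynomial curve `g`, the value of `P` is a one-variable polynomial over a domain, so
infinitely many zeros make it vanish identically. It is used over `ℂ` and over `ℂ⟦X⟧`. -/
theorem aeval_eval_eq_zero_of_infinite {ι R : Type*} [CommRing R] [IsDomain R] [Algebra ℂ R]
    (g : ι → Polynomial R) (P : MvPolynomial ι ℂ) {S : Set R} (hS : S.Infinite)
    (h : ∀ x ∈ S, MvPolynomial.aeval (fun i => (g i).eval x) P = 0) (x : R) :
    MvPolynomial.aeval (fun i => (g i).eval x) P = 0 := by
  have key (y : R) : (MvPolynomial.aeval g P).eval y =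
      MvPolynomial.aeval (fun i => (g i).eval y) P := by
    have := MvPolynomial.comp_aeval_apply (R := ℂ) (f := g)
      ((Polynomial.aeval (R := R) y).restrictScalars ℂ) P
    simpa [Polynomial.coe_aeval_eq_eval] using this
  have h0 : MvPolynomial.aeval g P = 0 := by
    refine Polynomial.eq_zero_of_infinite_isRoot _ (hS.mono fun y hy => ?_)
    rw [Set.mem_ofPred_eq, Polynomial.IsRoot.def, key, h y hy]
  rw [← key, h0, Polynomial.eval_zero]

theorem aeval_values_eq_zero {P : MvPolynomial (Fin 3) ℂ} (hP : MvPolynomial.aeval gens P = 0)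
    (τ : ℍ) : MvPolynomial.aeval ![E2 τ, E₄ τ, E₆ τ] P = 0 := by
  have h := hasSum_coeff_aeval (F := gens) (v := ![E2 τ, E₄ τ, E₆ τ]) (q := 𝕢 1 τ)
    (fun i => by
      fin_cases i
      · exact hasSum_gens_zero τ
      · exact hasSum_gens_one τ
      · exact hasSum_gens_two τ) P
  rw [hP] at h
  exact h.unique (by simp)

theorem aeval_transformed_eq_zero {P : MvPolynomial (Fin 3) ℂ} (hP : MvPolynomial.aeval gens P = 0)
    (τ : ℍ) {c d : ℤ} (hcd : IsCoprime c d) :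
    MvPolynomial.aeval ![(c * τ + d : ℂ) ^ 2 * E2 τ - anomaly * c * (c * τ + d),
      (c * τ + d : ℂ) ^ 4 * E₄ τ, (c * τ + d : ℂ) ^ 6 * E₆ τ] P = 0 := by
  obtain ⟨γ, hγ⟩ := hcd.exists_SL2_row 1
  have h := aeval_values_eq_zero hP (γ • τ)
  have hd : denom γ τ = c * τ + d := by
    rw [ModularGroup.denom_apply, hγ.1, hγ.2]
  rwa [E2_smul, levelOne_smul, levelOne_smul, hd, hγ.1] at h

theorem aeval_twisted_values_eq_zero {P : MvPolynomial (Fin 3) ℂ} (hP : MvPolynomial.aeval gens P = 0)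
    (τ : ℍ) (s : ℂ) {u : ℂ} (hu : u ≠ 0) :
    MvPolynomial.aeval ![s, u ^ 4 * E₄ τ, u ^ 6 * E₆ τ] P = 0 := by
  have h1 (c : ℕ) (hc : c ≠ 0) (u : ℂ) : MvPolynomial.aeval
      ![u ^ 2 * E2 τ - anomaly * c * u, u ^ 4 * E₄ τ, u ^ 6 * E₆ τ] P = 0 := by
    -- For fixed `c ≠ 0` the rows `(c, 1 + cn)` are coprime and give infinitely many values of `cτ +
    -- d`, which can therefore be replaced by an arbitrary `u`.
    have := aeval_eval_eq_zero_of_infinite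
      ![Polynomial.X ^ 2 * Polynomial.C (E2 τ) - Polynomial.C (anomaly * c) * Polynomial.X,
        Polynomial.X ^ 4 * Polynomial.C (E₄ τ), Polynomial.X ^ 6 * Polynomial.C (E₆ τ)] P
      (S := Set.range fun n : ℕ => (c * τ + (1 + c * n : ℤ) : ℂ))
      (Set.infinite_range_of_injective fun m n hmn => by simpa [hc] using hmn)
      (by
        rintro _ ⟨n, rfl⟩
        convert aeval_transformed_eq_zero hP τ (c := c) (d := 1 + c * n) ⟨-n, 1, by ring⟩ using 2
        congr 1
        funext i
        fin_cases i <;> simp <;> ring) u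
    convert this using 2
    congr 1
    funext i
    fin_cases i <;> simp <;> ring
  -- Now `c` becomes the free variable; the final evaluation point is the one at which the first
  -- coordinate equals `s`.
  have h2 := aeval_eval_eq_zero_of_infinite
    ![Polynomial.C (u ^ 2 * E2 τ) - Polynomial.C (anomaly * u) * Polynomial.X,
      Polynomial.C (u ^ 4 * E₄ τ), Polynomial.C (u ^ 6 * E₆ τ)] P
    (S := Set.range fun n : ℕ => ((n + 1 : ℕ) : ℂ))
    (Set.infinite_range_of_injective fun m n hmn => by simpa using hmn)
    (by
      rintro _ ⟨n, rfl⟩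
      convert h1 (n + 1) n.succ_ne_zero u using 2
      congr 1
      funext i
      fin_cases i <;> simp
      ring) ((u ^ 2 * E2 τ - s) / (anomaly * u))
  convert h2 using 2
  congr 1
  funext i
  fin_cases i <;> simp
  field_simp [anomaly_ne_zero]
  ring

/-- For constant `T = u²` the pointwise relations, valid for all `τ`, give an identity of q-series.
This identity is polynomial in `T` and holds at infinitely many constants, hence at every power
series `T`. -/
theorem aeval_twisted_series_eq_zero {P : MvPolynomial (Fin 3) ℂ} (hP : MvPolynomial.aeval gens P = 0)
    (s : ℂ) (T : ℂ⟦X⟧) :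
    MvPolynomial.aeval ![PowerSeries.C s, T ^ 2 * gens 1, T ^ 3 * gens 2] P = 0 := by
  have h1 (v : ℂ) (hv : v ≠ 0) : MvPolynomial.aeval ![PowerSeries.C s,
      PowerSeries.C v ^ 2 * gens 1, PowerSeries.C v ^ 3 * gens 2] P = 0 := by
    obtain ⟨u, rfl⟩ := IsAlgClosed.exists_pow_nat_eq v two_pos
    refine eq_zero_of_hasSum_zero fun τ => ?_
    rw [← aeval_twisted_values_eq_zero hP τ s (ne_zero_pow two_ne_zero hv)]
    refine hasSum_coeff_aeval (fun i => ?_) P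
    fin_cases i
    · exact hasSum_coeff_C s _
    · refine ((hasSum_gens_one τ).mul_left (u ^ 4)).congr_fun fun n => ?_
      change PowerSeries.coeff n (PowerSeries.C (u ^ 2) ^ 2 * gens 1) * _ = _
      rw [← map_pow, PowerSeries.coeff_C_mul]
      ring
    · refine ((hasSum_gens_two τ).mul_left (u ^ 6)).congr_fun fun n => ?_
      change PowerSeries.coeff n (PowerSeries.C (u ^ 2) ^ 3 * gens 2) * _ = _
      rw [← map_pow, PowerSeries.coeff_C_mul]
      ring
  have h2 := aeval_eval_eq_zero_of_infinite
    ![Polynomial.C (PowerSeries.C s), Polynomial.X ^ 2 * Polynomial.C (gens 1),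
      Polynomial.X ^ 3 * Polynomial.C (gens 2)] P
    (S := Set.range fun n : ℕ => PowerSeries.C ((n + 1 : ℕ) : ℂ))
    (Set.infinite_range_of_injective fun m n hmn => by
      simpa using PowerSeries.C_injective hmn)
    (by
      rintro _ ⟨n, rfl⟩
      convert h1 ((n + 1 : ℕ) : ℂ) (by exact_mod_cast n.succ_ne_zero) using 2
      congr 1
      funext i
      fin_cases i <;> simp <;> ring) T
  convert h2 using 2
  congr 1
  funext i
  fin_cases i <;> simp <;> ring

theorem constantCoeff_gens_one : PowerSeries.constantCoeff (gens 1) = 1 := by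
  rw [gens_one, ← PowerSeries.coeff_zero_eq_constantCoeff_apply, E_qExpansion_coeff_zero _ ⟨2, rfl⟩]

theorem constantCoeff_gens_two : PowerSeries.constantCoeff (gens 2) = 1 := by
  rw [gens_two, ← PowerSeries.coeff_zero_eq_constantCoeff_apply, E_qExpansion_coeff_zero _ ⟨3, rfl⟩]

/-- As `ℂ` is algebraically closed, a power series algebraic over `ℂ` is constant. -/
theorem transcendental_of_coeff_one_ne_zero {F : ℂ⟦X⟧} (hF : F.coeff 1 ≠ 0) :
    Transcendental ℂ F := by
  intro h
  have hi := h.isIntegral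
  obtain ⟨a, ha⟩ := minpoly.mem_range_of_degree_eq_one ℂ F
    (IsAlgClosed.degree_eq_one_of_irreducible ℂ (minpoly.irreducible hi))
  apply hF
  rw [← ha, PowerSeries.algebraMap_apply]
  simp

theorem transcendental_gens_ratio : Transcendental ℂ (gens 1 ^ 3 * ((gens 2)⁻¹) ^ 2) := by
  apply transcendental_of_coeff_one_ne_zero
  have h1 := constantCoeff_gens_one
  have h2 := constantCoeff_gens_two
  have h1' : (gens 1).coeff 1 = 240 := by rw [gens_one, E₄_qExpansion_coeff_one]
  have h2' : (gens 2).coeff 1 = -504 := by rw [gens_two, E₆_qExpansion_coeff_one]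
  have hm : gens 2 * (gens 2)⁻¹ = 1 := PowerSeries.mul_inv_cancel _ (by simp [h2])
  have h3 : PowerSeries.constantCoeff (gens 2)⁻¹ = 1 := by simp [h2]
  have h3' : ((gens 2)⁻¹).coeff 1 = 504 := by
    generalize (gens 2)⁻¹ = G at hm h3 ⊢
    have := congrArg (PowerSeries.coeff 1) hm
    simp [PowerSeries.coeff_one_mul, h2, h3, h2', PowerSeries.coeff_one] at this
    linear_combination this
  simp [pow_succ, PowerSeries.coeff_one_mul, h1, h3, h1', h3']
  norm_num

theorem algebraicIndependent_gens : AlgebraicIndependent ℂ gens := by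
  rw [algebraicIndependent_iff]
  intro P hP
  have hm : gens 2 * (gens 2)⁻¹ = 1 :=
    PowerSeries.mul_inv_cancel _ (by simp [constantCoeff_gens_two])
  have h1 (s l y : ℂ) : MvPolynomial.aeval ![s, l ^ 2 * y, l ^ 3 * y] P = 0 := by
    set g : Fin 3 → Polynomial ℂ := ![Polynomial.C s, Polynomial.C (l ^ 2) * Polynomial.X,
      Polynomial.C (l ^ 3) * Polynomial.X] with hg
    have h2 : MvPolynomial.aeval g P = 0 := by
      refine transcendental_iff.1 transcendental_gens_ratio _ ?_
      -- The choice `T = l·E_4/E_6` turns `T²E_4` and `T³E_6` into `l²` and `l³` times the same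
      -- transcendental series `E_4³/E_6²`.
      rw [MvPolynomial.comp_aeval_apply,
        ← aeval_twisted_series_eq_zero hP s (PowerSeries.C l * (gens 1 * (gens 2)⁻¹))]
      congr 2
      funext i
      fin_cases i
      · simp [hg]
      · simp [hg]
        ring
      · simp [hg]
        linear_combination (-(PowerSeries.C l) ^ 3 * gens 1 ^ 3 * ((gens 2)⁻¹) ^ 2) * hm
    have h3 := MvPolynomial.comp_aeval_apply (f := g) (Polynomial.aeval y) P
    rw [h2, map_zero] at h3
    rw [h3]
    congr 2
    funext i
    fin_cases i <;> simp [hg]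
  -- Points `(s, l²y, l³y)` cover everything off the two coordinate hyperplanes; the factor `X 1 * X
  -- 2` handles the rest.
  have h2 : P * (MvPolynomial.X 1 * MvPolynomial.X 2) = 0 := by
    refine MvPolynomial.funext fun x => ?_
    rcases eq_or_ne (x 1) 0 with h | h
    · simp [h]
    rcases eq_or_ne (x 2) 0 with h' | h'
    · simp [h']
    have := h1 (x 0) (x 2 / x 1) (x 1 ^ 3 / x 2 ^ 2)
    have hx : ![x 0, (x 2 / x 1) ^ 2 * (x 1 ^ 3 / x 2 ^ 2),
        (x 2 / x 1) ^ 3 * (x 1 ^ 3 / x 2 ^ 2)] = x := by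
      funext i
      fin_cases i
      · rfl
      · simp
        field_simp
      · simp
        field_simp
    rw [hx] at this
    have h3 : MvPolynomial.eval x P = 0 := this
    rw [map_mul, h3, zero_mul, map_zero]
  simpa [MvPolynomial.X_ne_zero] using h2

/-! ### Modular forms of level one and `ℂ[E_4, E_6]` -/

theorem qExpansion_discriminant :
    qExpansion 1 ModularForm.discriminant = (1 / 1728 : ℂ) • (gens 1 ^ 3 - gens 2 ^ 2) := by
  set D : ModularForm 𝒮ℒ 12 := (1 / 1728 : ℂ) •
    (ModularForm.mcast (by decide) (E₄.pow 3) - ModularForm.mcast (by decide) (E₆.pow 2)) with hD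
  have h : (ModularForm.discriminant : ℍ → ℂ) = D := by
    ext z
    rw [discriminant_eq_E₄_cube_sub_E₆_sq, hD]
    simp only [ModularForm.coe_mcast, ModularForm.coe_pow, FunLike.coe_smul, FunLike.coe_sub,
      Pi.smul_apply, Pi.sub_apply, Pi.pow_apply, smul_eq_mul]
    ring
  rw [h, hD, FunLike.coe_smul, ModularForm.qExpansion_smul one_pos one_mem_strictPeriods_SL,
    FunLike.coe_sub, ModularForm.qExpansion_sub one_pos one_mem_strictPeriods_SL,
    ModularForm.qExpansion_mcast, ModularForm.qExpansion_mcast,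
    ModularForm.qExpansion_pow one_pos one_mem_strictPeriods_SL,
    ModularForm.qExpansion_pow one_pos one_mem_strictPeriods_SL, gens_one, gens_two]

/-- The ring `ℂ[E_4, E_6]` of modular forms of level one. -/
abbrev modularRing : Subalgebra ℂ ℂ⟦X⟧ := Algebra.adjoin ℂ {gens 1, gens 2}

theorem gens_one_mem : gens 1 ∈ modularRing := Algebra.subset_adjoin (by simp)

theorem gens_two_mem : gens 2 ∈ modularRing := Algebra.subset_adjoin (by simp)

/-- Induction on the weight: subtracting a multiple of a monomial `E_4^a E_6^b` leaves a cusp form,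
which is the discriminant times a form of weight `k - 12`. Integer weights let the descent end among
negative ones. -/
theorem qExpansion_mem_modularRing (n : ℕ) (k : ℤ) (hk : k < n) (f : ModularForm 𝒮ℒ k) :
    qExpansion 1 f ∈ modularRing := by
  induction n using Nat.strong_induction_on generalizing k with
  | h n ih =>
  rcases lt_or_ge k 0 with h | h
  · rw [ModularFormClass.levelOne_neg_weight_eq_zero h f, qExpansion_zero]
    exact zero_mem _
  rcases Int.even_or_odd k with he | ho
  swap
  · rw [ModularForm.levelOne_odd_weight_eq_zero ho f, FunLike.coe_zero, qExpansion_zero]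
    exact zero_mem _
  by_cases h2 : k = 2
  · subst h2
    rw [rank_zero_iff_forall_zero.1 levelOne_weight_two_rank_zero f, FunLike.coe_zero,
      qExpansion_zero]
    exact zero_mem _
  obtain ⟨a, b, hab⟩ : ∃ a b : ℕ, (a : ℤ) * 4 + b * 6 = k := by
    obtain ⟨m, rfl⟩ := he
    lift m to ℕ using by lia
    rcases Nat.even_or_odd m with ⟨r, hr⟩ | ⟨r, hr⟩
    · exact ⟨r, 0, by lia⟩
    · exact ⟨r - 1, 1, by lia⟩
  set M : ModularForm 𝒮ℒ k := ModularForm.mcast (by simpa using hab) ((E₄.pow a).mul (E₆.pow b))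
    with hM
  have hMq : qExpansion 1 M = gens 1 ^ a * gens 2 ^ b := by
    rw [hM, ModularForm.qExpansion_mcast, ModularForm.qExpansion_mul one_pos one_mem_strictPeriods_SL,
      ModularForm.qExpansion_pow one_pos one_mem_strictPeriods_SL,
      ModularForm.qExpansion_pow one_pos one_mem_strictPeriods_SL, gens_one, gens_two]
  have hMmem : qExpansion 1 M ∈ modularRing :=
    hMq ▸ mul_mem (pow_mem gens_one_mem _) (pow_mem gens_two_mem _)
  set c := (qExpansion 1 f).coeff 0 with hc
  have hsub : qExpansion 1 (f - c • M : ModularForm 𝒮ℒ k) = qExpansion 1 f - c • qExpansion 1 M := by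
    rw [FunLike.coe_sub, ModularForm.qExpansion_sub one_pos one_mem_strictPeriods_SL,
      FunLike.coe_smul, ModularForm.qExpansion_smul one_pos one_mem_strictPeriods_SL]
  have h0 : (qExpansion 1 (f - c • M : ModularForm 𝒮ℒ k)).coeff 0 = 0 := by
    rw [hsub, map_sub, ← hc, PowerSeries.coeff_smul, hMq]
    simp [constantCoeff_gens_one, constantCoeff_gens_two]
  have hfac := qExpansion_eq_qExpansion_discriminant_mul _ h0
  have hmem : qExpansion 1 (f - c • M : ModularForm 𝒮ℒ k) ∈ modularRing := by
    rw [hfac, qExpansion_discriminant]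
    refine mul_mem (Subalgebra.smul_mem _ (sub_mem (pow_mem gens_one_mem _)
      (pow_mem gens_two_mem _)) _) ?_
    exact ih k.toNat (by lia) (k - 12) (by lia) _
  rw [hsub] at hmem
  simpa using add_mem hmem (Subalgebra.smul_mem _ hMmem c)

/-- `G` is the partial derivative with respect to `E_2` of `F`, both written as polynomials in
`E_2, E_4, E_6`. -/
def IsPartialE2 (F G : ℂ⟦X⟧) : Prop :=
  ∃ P : MvPolynomial (Fin 3) ℂ,
    MvPolynomial.aeval gens P = F ∧ MvPolynomial.aeval gens (MvPolynomial.pderiv 0 P) = G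

/-! ### Calculus of `∂/∂E_2` -/

namespace IsPartialE2

variable {F G F' G' : ℂ⟦X⟧}

theorem add (h : IsPartialE2 F G) (h' : IsPartialE2 F' G') : IsPartialE2 (F + F') (G + G') := by
  obtain ⟨P, rfl, rfl⟩ := h
  obtain ⟨Q, rfl, rfl⟩ := h'
  exact ⟨P + Q, by simp, by simp⟩

theorem mul (h : IsPartialE2 F G) (h' : IsPartialE2 F' G') :
    IsPartialE2 (F * F') (G * F' + F * G') := by
  obtain ⟨P, rfl, rfl⟩ := h
  obtain ⟨Q, rfl, rfl⟩ := h'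
  refine ⟨P * Q, by simp, ?_⟩
  simp
  ring

theorem smul (c : ℂ) (h : IsPartialE2 F G) : IsPartialE2 (c • F) (c • G) := by
  obtain ⟨P, rfl, rfl⟩ := h
  exact ⟨c • P, by simp, by simp⟩

theorem const (c : ℂ) : IsPartialE2 (algebraMap ℂ ℂ⟦X⟧ c) 0 :=
  ⟨MvPolynomial.C c, by simp, by simp⟩

theorem sum {ι : Type*} (s : Finset ι) {f g : ι → ℂ⟦X⟧} (h : ∀ i ∈ s, IsPartialE2 (f i) (g i)) :
    IsPartialE2 (∑ i ∈ s, f i) (∑ i ∈ s, g i) := by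
  classical
  induction s using Finset.induction_on with
  | empty => simpa using const 0
  | insert a s ha ih =>
    rw [Finset.sum_insert ha, Finset.sum_insert ha]
    exact (h a (by simp)).add (ih fun i hi => h i (by simp [hi]))

theorem gens_zero : IsPartialE2 (gens 0) 1 :=
  ⟨MvPolynomial.X 0, by simp, by simp⟩

theorem of_mem_modularRing (h : F ∈ modularRing) : IsPartialE2 F 0 := by
  induction h using Algebra.adjoin_induction with
  | mem x hx =>
    rcases hx with rfl | rfl
    · exact ⟨MvPolynomial.X 1, by simp, by simp [MvPolynomial.pderiv_X]⟩
    · exact ⟨MvPolynomial.X 2, by simp, by simp [MvPolynomial.pderiv_X]⟩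
  | algebraMap r => exact const r
  | add x y _ _ hx hy => simpa using hx.add hy
  | mul x y _ _ hx hy => simpa using hx.mul hy

theorem mem (h : IsPartialE2 F G) : F ∈ quasimodularRing := by
  obtain ⟨P, rfl, -⟩ := h
  rw [quasimodularRing, Algebra.adjoin_range_eq_range_aeval]
  exact ⟨P, rfl⟩

/-- Only here does algebraic independence enter: it makes the polynomial representing `F` unique. -/
theorem partialE2_eq (h : IsPartialE2 F G) (hE : AlgebraicIndependent ℂ gens)
    (hF : F ∈ quasimodularRing) : (partialE2 hE ⟨F, hF⟩ : ℂ⟦X⟧) = G := by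
  obtain ⟨P, rfl, rfl⟩ := h
  have : hE.aevalEquiv.symm ⟨MvPolynomial.aeval gens P, hF⟩ = P := by
    rw [AlgEquiv.symm_apply_eq]
    ext1
    simp
  rw [partialE2, this]
  simp

end IsPartialE2

/-- The series `∑_{n ≥ 1} σ_{2k-1}(n) qⁿ`. -/
def sigmaSeries (k : ℕ) : ℂ⟦X⟧ := PowerSeries.mk (fun n => ((σ (2 * k - 1) n : ℕ) : ℂ))

theorem sigmaSeries_eq {k : ℕ} (hk : k ≠ 0) : sigmaSeries k =
    ((bernoulli (2 * k) : ℚ) / (4 * k) : ℂ) • (algebraMap ℂ ℂ⟦X⟧ 1 + (-1 : ℂ) • eisensteinSeries k) := by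
  have hb : ((bernoulli (2 * k) : ℚ) : ℂ) ≠ 0 := by exact_mod_cast bernoulli_two_mul_ne_zero k
  have hk' : (k : ℂ) ≠ 0 := by exact_mod_cast hk
  rw [eisensteinSeries, ← sigmaSeries, map_one, neg_one_smul, neg_sub, add_sub_cancel, smul_smul]
  field_simp
  simp

theorem isPartialE2_sigmaSeries_one :
    IsPartialE2 (sigmaSeries 1) (algebraMap ℂ ℂ⟦X⟧ (-1 / 24)) := by
  rw [sigmaSeries_eq one_ne_zero]
  have h := ((IsPartialE2.const 1).add (IsPartialE2.gens_zero.smul (-1))).smul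
    ((bernoulli (2 * 1) : ℚ) / (4 * (1 : ℕ)) : ℂ)
  have hc : (algebraMap ℂ ℂ⟦X⟧ (-1 / 24)) =
      ((bernoulli (2 * 1) : ℚ) / (4 * (1 : ℕ)) : ℂ) • (0 + (-1 : ℂ) • (1 : ℂ⟦X⟧)) := by
    rw [zero_add, smul_smul, Algebra.algebraMap_eq_smul_one]
    congr 1
    norm_num [bernoulli_two]
  rwa [hc]

theorem isPartialE2_sigmaSeries {k : ℕ} (hk : 2 ≤ k) : IsPartialE2 (sigmaSeries k) 0 := by
  rw [sigmaSeries_eq (by lia)]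
  have h : eisensteinSeries k ∈ modularRing := by
    rw [eisensteinSeries_eq_qExpansion (by lia)]
    exact qExpansion_mem_modularRing (2 * k + 1) _ (by lia) _
  simpa using ((IsPartialE2.const 1).add ((IsPartialE2.of_mem_modularRing h).smul (-1))).smul
    ((bernoulli (2 * k) : ℚ) / (4 * k) : ℂ)

end

end MacMahonQM

namespace MacMahonQM

open scoped PowerSeries ArithmeticFunction.sigma

noncomputable section

/-! ### Symmetric sums and Newton's identities -/

section Newton

variable {R : Type*} [CommRing R]

open Classical in
/-- The sum of `y_{k_1} ⋯ y_{k_t}` over all `k_1, …, k_t < N` with the property `p`. -/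
def multiSum (y : ℕ → R) (N : ℕ) {t : ℕ} (p : (Fin t → ℕ) → Prop) : R :=
  ∑ k ∈ (Fintype.piFinset fun _ : Fin t => Finset.range N).filter p, ∏ i, y (k i)

/-- The elementary symmetric polynomial of degree `t` in `y_0, …, y_{N-1}`. -/
def elemSum (y : ℕ → R) (N t : ℕ) : R := multiSum y N (t := t) StrictMono

/-- The complete homogeneous symmetric polynomial of degree `t` in `y_0, …, y_{N-1}`. -/
def complSum (y : ℕ → R) (N t : ℕ) : R := multiSum y N (t := t) Monotone

theorem multiSum_degree_zero (y : ℕ → R) (N : ℕ) {p : (Fin 0 → ℕ) → Prop} (hp : ∀ k, p k) :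
    multiSum y N p = 1 := by
  classical
  unfold multiSum
  rw [Finset.filter_true_of_mem fun k _ => hp k]
  simp

theorem multiSum_zero_succ (y : ℕ → R) {t : ℕ} (p : (Fin (t + 1) → ℕ) → Prop) :
    multiSum y 0 p = 0 := by
  classical
  refine Finset.sum_eq_zero fun k hk => ?_
  have := Fintype.mem_piFinset.1 (Finset.mem_filter.1 hk).1 0
  simp at this

/-- Tuples are split by whether the last, hence largest, index is `N`. The bound `M` for the
remaining indices will be `N` in the strict case and `N + 1` in the weak one. -/
theorem multiSum_succ_succ (y : ℕ → R) (N M : ℕ) {t : ℕ} {p : (Fin t → ℕ) → Prop}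
    {p' : (Fin (t + 1) → ℕ) → Prop} (hp' : ∀ k, p' k → Monotone k)
    (hsnoc : ∀ k : Fin t → ℕ, ((∀ i, k i < N + 1) ∧ p' (Fin.snoc k N : Fin (t + 1) → ℕ)) ↔
      ((∀ i, k i < M) ∧ p k)) :
    multiSum y (N + 1) p' = multiSum y N p' + y N * multiSum y M p := by
  classical
  unfold multiSum
  rw [← Finset.sum_filter_add_sum_filter_not _ (fun k => k (Fin.last t) < N)]
  congr 1
  · refine Finset.sum_congr ?_ fun _ _ => rfl
    ext k
    simp only [Finset.mem_filter, Fintype.mem_piFinset, Finset.mem_range]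
    constructor
    · rintro ⟨⟨-, h2⟩, h3⟩
      exact ⟨fun i => (hp' k h2 (Fin.le_last i)).trans_lt h3, h2⟩
    · rintro ⟨h1, h2⟩
      exact ⟨⟨fun i => (h1 i).trans N.lt_succ_self, h2⟩, h1 _⟩
  · rw [Finset.mul_sum]
    refine Finset.sum_nbij' (fun k => Fin.init k) (fun k => Fin.snoc k N) ?_ ?_ ?_ ?_ ?_
    · intro k hk
      simp only [Finset.mem_filter, Fintype.mem_piFinset, Finset.mem_range] at hk ⊢
      obtain ⟨⟨h1, h2⟩, h3⟩ := hk
      have h4 : k (Fin.last t) = N := by have := h1 (Fin.last t); lia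
      refine (hsnoc (Fin.init k)).1 ⟨fun i => h1 _, ?_⟩
      rwa [← h4, Fin.snoc_init_self]
    · intro k hk
      simp only [Finset.mem_filter, Fintype.mem_piFinset, Finset.mem_range] at hk ⊢
      obtain ⟨h1, h2⟩ := (hsnoc k).2 hk
      refine ⟨⟨fun i => ?_, h2⟩, by simp⟩
      refine Fin.lastCases ?_ (fun j => ?_) i
      · simp
      · simpa using h1 j
    · intro k hk
      simp only [Finset.mem_filter, Fintype.mem_piFinset, Finset.mem_range] at hk
      obtain ⟨⟨h1, h2⟩, h3⟩ := hk
      have h4 : k (Fin.last t) = N := by have := h1 (Fin.last t); lia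
      rw [← h4, Fin.snoc_init_self]
    · intro k hk
      simp
    · intro k hk
      simp only [Finset.mem_filter, Fintype.mem_piFinset, Finset.mem_range] at hk
      obtain ⟨⟨h1, h2⟩, h3⟩ := hk
      have h4 : k (Fin.last t) = N := by have := h1 (Fin.last t); lia
      rw [Fin.prod_univ_castSucc, h4, mul_comm]
      rfl

theorem strictMono_snoc_iff {t N : ℕ} (k : Fin t → ℕ) :
    StrictMono (Fin.snoc k N : Fin (t + 1) → ℕ) ↔ (∀ i, k i < N) ∧ StrictMono k := by
  constructor
  · refine fun h => ⟨fun i => ?_, fun i j hij => ?_⟩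
    · simpa using h (Fin.castSucc_lt_last i)
    · simpa using h (Fin.castSucc_lt_castSucc_iff.2 hij)
  · rintro ⟨h1, h2⟩ i j hij
    induction j using Fin.lastCases with
    | last =>
      induction i using Fin.lastCases with
      | last => exact absurd hij (lt_irrefl _)
      | cast i => simpa using h1 i
    | cast j =>
      induction i using Fin.lastCases with
      | last => exact absurd hij (Fin.castSucc_lt_last j).not_gt
      | cast i => simpa using h2 (Fin.castSucc_lt_castSucc_iff.1 hij)

theorem monotone_snoc_iff {t N : ℕ} (k : Fin t → ℕ) :
    Monotone (Fin.snoc k N : Fin (t + 1) → ℕ) ↔ (∀ i, k i < N + 1) ∧ Monotone k := by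
  constructor
  · refine fun h => ⟨fun i => Nat.lt_succ_of_le ?_, fun i j hij => ?_⟩
    · simpa using h (Fin.castSucc_lt_last i).le
    · simpa using h (Fin.castSucc_le_castSucc_iff.2 hij)
  · rintro ⟨h1, h2⟩ i j hij
    induction j using Fin.lastCases with
    | last =>
      induction i using Fin.lastCases with
      | last => exact le_rfl
      | cast i => simpa using Nat.le_of_lt_succ (h1 i)
    | cast j =>
      induction i using Fin.lastCases with
      | last => exact absurd hij (Fin.castSucc_lt_last j).not_ge
      | cast i => simpa using h2 (Fin.castSucc_le_castSucc_iff.1 hij)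

theorem elemSum_zero_right (y : ℕ → R) (N : ℕ) : elemSum y N 0 = 1 :=
  multiSum_degree_zero y N fun k => Subsingleton.strictMono k

theorem complSum_zero_right (y : ℕ → R) (N : ℕ) : complSum y N 0 = 1 :=
  multiSum_degree_zero y N fun k => Subsingleton.monotone k

theorem elemSum_succ_succ (y : ℕ → R) (N t : ℕ) :
    elemSum y (N + 1) (t + 1) = elemSum y N (t + 1) + y N * elemSum y N t :=
  multiSum_succ_succ y N N (fun _ h => h.monotone) fun k => by
    rw [strictMono_snoc_iff]
    exact ⟨fun h => h.2, fun h => ⟨fun i => (h.1 i).trans N.lt_succ_self, h⟩⟩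

theorem complSum_succ_succ (y : ℕ → R) (N t : ℕ) :
    complSum y (N + 1) (t + 1) = complSum y N (t + 1) + y N * complSum y (N + 1) t :=
  multiSum_succ_succ y N (N + 1) (fun _ h => h) fun k => by
    rw [monotone_snoc_iff]
    tauto

theorem mk_elemSum_zero (y : ℕ → R) : PowerSeries.mk (elemSum y 0) = 1 := by
  ext t
  rcases t with _ | t
  · simp [elemSum_zero_right]
  · simp [elemSum, multiSum_zero_succ, PowerSeries.coeff_one]

theorem mk_complSum_zero (y : ℕ → R) : PowerSeries.mk (complSum y 0) = 1 := by
  ext t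
  rcases t with _ | t
  · simp [complSum_zero_right]
  · simp [complSum, multiSum_zero_succ, PowerSeries.coeff_one]

theorem mk_elemSum_succ (y : ℕ → R) (N : ℕ) : PowerSeries.mk (elemSum y (N + 1)) =
    (1 + PowerSeries.X * PowerSeries.C (y N)) * PowerSeries.mk (elemSum y N) := by
  ext t
  rw [add_mul, one_mul, mul_assoc, map_add]
  rcases t with _ | t
  · simp [elemSum_zero_right]
  · simp [elemSum_succ_succ, PowerSeries.coeff_succ_X_mul]

theorem mk_complSum_succ (y : ℕ → R) (N : ℕ) : PowerSeries.mk (complSum y N) =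
    (1 - PowerSeries.X * PowerSeries.C (y N)) * PowerSeries.mk (complSum y (N + 1)) := by
  ext t
  rw [sub_mul, one_mul, mul_assoc, map_sub]
  rcases t with _ | t
  · simp [complSum_zero_right]
  · simp [complSum_succ_succ, PowerSeries.coeff_succ_X_mul]

theorem one_sub_mul_mk_pow (a : R) :
    (1 - PowerSeries.X * PowerSeries.C a) * PowerSeries.mk (fun j => a ^ j) = 1 := by
  ext t
  rw [sub_mul, one_mul, mul_assoc, map_sub]
  rcases t with _ | t
  · simp
  · simp [PowerSeries.coeff_succ_X_mul, PowerSeries.coeff_one, pow_succ']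

/-- Logarithmic derivative of `∏ (1 + y_i T)`, with `y_i/(1 + y_i T)` written as a geometric series.
-/
theorem derivative_mk_elemSum (y : ℕ → R) (N : ℕ) :
    PowerSeries.derivative R (PowerSeries.mk (elemSum y N)) = PowerSeries.mk (elemSum y N) *
      ∑ i ∈ Finset.range N, PowerSeries.C (y i) * PowerSeries.mk (fun j => (-y i) ^ j) := by
  induction N with
  | zero => simp [mk_elemSum_zero]
  | succ N ih =>
    have h := one_sub_mul_mk_pow (-y N)
    rw [map_neg] at h
    rw [mk_elemSum_succ, Finset.sum_range_succ, Derivation.leibniz, ih]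
    simp only [map_add, Derivation.leibniz, smul_eq_mul, PowerSeries.derivative_X,
      PowerSeries.derivative_C, Derivation.map_one_eq_zero]
    linear_combination (-PowerSeries.C (y N) * PowerSeries.mk (elemSum y N)) * h

theorem derivative_mk_complSum (y : ℕ → R) (N : ℕ) :
    PowerSeries.derivative R (PowerSeries.mk (complSum y N)) = PowerSeries.mk (complSum y N) *
      ∑ i ∈ Finset.range N, PowerSeries.C (y i) * PowerSeries.mk (fun j => y i ^ j) := by
  induction N with
  | zero => simp [mk_complSum_zero]
  | succ N ih =>
    have h := one_sub_mul_mk_pow (y N)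
    rw [mk_complSum_succ, Derivation.leibniz] at ih
    simp only [map_sub, Derivation.leibniz, smul_eq_mul, PowerSeries.derivative_X,
      PowerSeries.derivative_C, Derivation.map_one_eq_zero] at ih
    rw [Finset.sum_range_succ]
    set H := PowerSeries.mk (complSum y (N + 1))
    set D := PowerSeries.derivative R H
    set G := PowerSeries.mk (fun j => y N ^ j)
    set A := ∑ i ∈ Finset.range N, PowerSeries.C (y i) * PowerSeries.mk (fun j => y i ^ j)
    linear_combination G * ih + (H * A - D) * h

/-- Newton's identities for the elementary symmetric polynomials. -/
theorem succ_mul_elemSum_succ (y : ℕ → R) (N t : ℕ) :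
    ((t : R) + 1) * elemSum y N (t + 1) = ∑ x ∈ Finset.HasAntidiagonal.antidiagonal t,
      elemSum y N x.1 * ((-1) ^ x.2 * ∑ i ∈ Finset.range N, y i ^ (x.2 + 1)) := by
  have h := congrArg (PowerSeries.coeff t) (derivative_mk_elemSum y N)
  rw [PowerSeries.coeff_derivative, PowerSeries.coeff_mul, PowerSeries.coeff_mk] at h
  rw [mul_comm, h]
  refine Finset.sum_congr rfl fun x _ => ?_
  simp only [PowerSeries.coeff_mk, map_sum, PowerSeries.coeff_C_mul, Finset.mul_sum]
  refine Finset.sum_congr rfl fun i _ => ?_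
  rw [neg_pow]
  ring

/-- Newton's identities for the complete homogeneous symmetric polynomials. -/
theorem succ_mul_complSum_succ (y : ℕ → R) (N t : ℕ) :
    ((t : R) + 1) * complSum y N (t + 1) = ∑ x ∈ Finset.HasAntidiagonal.antidiagonal t,
      complSum y N x.1 * ∑ i ∈ Finset.range N, y i ^ (x.2 + 1) := by
  have h := congrArg (PowerSeries.coeff t) (derivative_mk_complSum y N)
  rw [PowerSeries.coeff_derivative, PowerSeries.coeff_mul, PowerSeries.coeff_mk] at h
  rw [mul_comm, h]
  refine Finset.sum_congr rfl fun x _ => ?_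
  simp only [PowerSeries.coeff_mk, map_sum, PowerSeries.coeff_C_mul]
  congr 1
  refine Finset.sum_congr rfl fun i _ => ?_
  ring

theorem derivative_mul (F G : R⟦X⟧) : PowerSeries.derivative R (F * G) =
    F * PowerSeries.derivative R G + G * PowerSeries.derivative R F :=
  Derivation.leibniz _ F G

end Newton

/-! ### From finitely many to infinitely many variables -/

/-- The series `q^{k+1} / (1 - q^{k+1})²`. -/
def factor (k : ℕ) : ℂ⟦X⟧ :=
  PowerSeries.X ^ (k + 1) * ((1 - PowerSeries.X ^ (k + 1)) ^ 2)⁻¹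

-- A product involving an index `k ≥ N` is divisible by `X^(N+1)`, because indices are shifted to
-- start at 0; the coefficient of `X^n` with `n ≤ N` thus comes from a finite sum.
open scoped PowerSeries.WithPiTopology in
theorem coeff_tsum_summand {t : ℕ} (p : (Fin t → ℕ+) → Prop) (p' : (Fin t → ℕ) → Prop)
    (hp : ∀ k, p' k ↔ p fun i => (k i).succPNat) {n N : ℕ} (hN : n ≤ N) :
    (∑' k : {k : Fin t → ℕ+ // p k}, summand k.1).coeff n =
      (multiSum factor N p').coeff n := by
  classical
  have h1 := (PowerSeries.WithPiTopology.hasSum_iff_hasSum_coeff ℂ).1 (summable_summand t p).hasSum n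
  rw [← h1.tsum_eq]
  let e : {k : Fin t → ℕ // p' k} ≃ {k : Fin t → ℕ+ // p k} :=
    (Equiv.arrowCongr (Equiv.refl _) Equiv.pnatEquivNat.symm).subtypeEquiv fun k => hp k
  rw [← e.tsum_eq]
  have h2 (k : {k : Fin t → ℕ // p' k}) :
      PowerSeries.coeff n (summand (e k).1) = PowerSeries.coeff n (∏ i, factor (k.1 i)) := rfl
  simp_rw [h2]
  refine (tsum_subtype {k | p' k} (fun k => PowerSeries.coeff n (∏ i, factor (k i)))).trans ?_
  rw [tsum_eq_sum (s := Fintype.piFinset fun _ : Fin t => Finset.range N), multiSum, map_sum,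
    Finset.sum_filter]
  · rfl
  · intro k hk
    simp only [Fintype.mem_piFinset, Finset.mem_range, not_forall, not_lt] at hk
    obtain ⟨i, hi⟩ := hk
    rw [Set.indicator_apply_eq_zero]
    intro _
    exact coeff_summand_eq_zero (fun i => (k i).succPNat) n i
      (by simpa using Nat.lt_succ_of_le (hN.trans hi))

theorem coeff_macMahonU {n N : ℕ} (t : ℕ) (hN : n ≤ N) :
    (macMahonU t).coeff n = (elemSum factor N t).coeff n :=
  coeff_tsum_summand _ _ (fun k => by simp [StrictMono]) hN

theorem coeff_macMahonUStar {n N : ℕ} (t : ℕ) (hN : n ≤ N) :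
    (macMahonUStar t).coeff n = (complSum factor N t).coeff n :=
  coeff_tsum_summand _ _ (fun k => by simp [Monotone]) hN

/-- The power sum `∑_{k ≥ 1} (q^k / (1 - q^k)²)^{m+1}`, in its expanded form. -/
def powerSum (m : ℕ) : ℂ⟦X⟧ :=
  PowerSeries.mk fun n => ∑ d ∈ n.divisors, ((d + m).choose (2 * m + 1) : ℂ)

/-! ### Power sums as combinations of divisor sums -/

theorem factor_eq_expand (k : ℕ) :
    factor k = PowerSeries.expand (k + 1) k.succ_ne_zero (factor 0) := by
  have h (j : ℕ) : (1 - (PowerSeries.X : ℂ⟦X⟧) ^ (j + 1)) ^ 2 * ((1 - PowerSeries.X ^ (j + 1)) ^ 2)⁻¹ = 1 :=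
    PowerSeries.mul_inv_cancel _ (by simp)
  have h0 := congrArg (PowerSeries.expand (k + 1) k.succ_ne_zero) (h 0)
  simp only [zero_add, pow_one, map_mul, map_pow, map_sub, map_one, PowerSeries.expand_X] at h0
  simp only [factor, zero_add, pow_one, map_mul, PowerSeries.expand_X]
  congr 1
  have h1 := h k
  generalize ((1 - (PowerSeries.X : ℂ⟦X⟧) ^ (k + 1)) ^ 2)⁻¹ = A at h1 ⊢
  generalize PowerSeries.expand (k + 1) k.succ_ne_zero (((1 - (PowerSeries.X : ℂ⟦X⟧)) ^ 2)⁻¹) = B at h0 ⊢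
  linear_combination B * h1 - A * h0

theorem factor_zero_pow (m : ℕ) :
    factor 0 ^ (m + 1) = PowerSeries.mk fun n => ((n + m).choose (2 * m + 1) : ℂ) := by
  have h : ((1 - (PowerSeries.X : ℂ⟦X⟧)) ^ 2)⁻¹ ^ (m + 1) =
      PowerSeries.mk fun n => ((2 * m + 1 + n).choose (2 * m + 1) : ℂ) := by
    rw [← PowerSeries.invOneSubPow_val_succ_eq_mk_add_choose]
    have h1 : (1 - (PowerSeries.X : ℂ⟦X⟧)) ^ 2 * ((1 - (PowerSeries.X : ℂ⟦X⟧)) ^ 2)⁻¹ = 1 :=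
      PowerSeries.mul_inv_cancel _ (by simp)
    have h2 := (PowerSeries.invOneSubPow ℂ (2 * m + 1 + 1)).val_inv
    rw [PowerSeries.invOneSubPow_inv_eq_one_sub_pow] at h2
    have h3 := congrArg (· ^ (m + 1)) h1
    simp only [mul_pow, one_pow, ← pow_mul] at h3
    rw [show 2 * m + 1 + 1 = 2 * (m + 1) by ring] at h2 ⊢
    generalize ((1 - (PowerSeries.X : ℂ⟦X⟧)) ^ 2)⁻¹ ^ (m + 1) = A at h3 ⊢
    generalize (PowerSeries.invOneSubPow ℂ (2 * (m + 1))).val = B at h2 ⊢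
    linear_combination B * h3 - A * h2
  simp only [factor, zero_add, pow_one, mul_pow]
  rw [h]
  ext n
  rw [PowerSeries.coeff_X_pow_mul', PowerSeries.coeff_mk, PowerSeries.coeff_mk]
  split_ifs with hn
  · rw [show 2 * m + 1 + (n - (m + 1)) = n + m by lia]
  · rw [Nat.choose_eq_zero_of_lt (by lia), Nat.cast_zero]

theorem coeff_powerSum {n N : ℕ} (m : ℕ) (hN : n ≤ N) :
    (powerSum m).coeff n = (∑ k ∈ Finset.range N, factor k ^ (m + 1)).coeff n := by
  rw [map_sum]
  have h (k : ℕ) : (factor k ^ (m + 1)).coeff n =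
      if (k + 1) ∣ n then ((n / (k + 1) + m).choose (2 * m + 1) : ℂ) else 0 := by
    rw [factor_eq_expand, ← map_pow, PowerSeries.coeff_expand, factor_zero_pow, PowerSeries.coeff_mk]
  simp_rw [h]
  rw [powerSum, PowerSeries.coeff_mk]
  rcases eq_or_ne n 0 with rfl | hn
  · simp [Nat.choose_eq_zero_of_lt (show m < 2 * m + 1 by lia)]
  -- The divisor `d` is exchanged with `n / d`, so that `k + 1` is the divisor complementary to the
  -- one in the binomial coefficient.
  rw [← Nat.sum_div_divisors n fun d => ((d + m).choose (2 * m + 1) : ℂ), ← Finset.sum_filter]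
  refine Finset.sum_nbij' (fun d => d - 1) (fun k => k + 1) ?_ ?_ ?_ ?_ ?_
  · intro d hd
    have := Nat.pos_of_mem_divisors hd
    have := Nat.divisor_le hd
    have := Nat.dvd_of_mem_divisors hd
    simp only [Finset.mem_filter, Finset.mem_range]
    exact ⟨by lia, by rwa [Nat.sub_add_cancel (by lia)]⟩
  · intro k hk
    simp only [Finset.mem_filter, Finset.mem_range] at hk
    simp [hk.2, hn]
  · intro d hd
    have := Nat.pos_of_mem_divisors hd
    exact Nat.sub_add_cancel (by lia)
  · intro k _
    rfl
  · intro d hd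
    have := Nat.pos_of_mem_divisors hd
    rw [Nat.sub_add_cancel (by lia)]

theorem coeff_mul_congr {F F' G G' : ℂ⟦X⟧} {n : ℕ} (hF : ∀ m ≤ n, F.coeff m = F'.coeff m)
    (hG : ∀ m ≤ n, G.coeff m = G'.coeff m) : (F * G).coeff n = (F' * G').coeff n := by
  rw [PowerSeries.coeff_mul, PowerSeries.coeff_mul]
  refine Finset.sum_congr rfl fun x hx => ?_
  have := Finset.HasAntidiagonal.mem_antidiagonal.1 hx
  rw [hF _ (by lia), hG _ (by lia)]

theorem succ_mul_macMahonU_succ (t : ℕ) :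
    ((t : ℂ) + 1) • macMahonU (t + 1) = ∑ x ∈ Finset.HasAntidiagonal.antidiagonal t,
      macMahonU x.1 * ((-1 : ℂ) ^ x.2 • powerSum x.2) := by
  ext n
  have h := congrArg (PowerSeries.coeff n) (succ_mul_elemSum_succ factor n t)
  rw [show (t : ℂ⟦X⟧) + 1 = PowerSeries.C ((t : ℂ) + 1) by simp, PowerSeries.coeff_C_mul] at h
  rw [PowerSeries.coeff_smul, smul_eq_mul, coeff_macMahonU _ le_rfl, h, map_sum, map_sum]
  refine Finset.sum_congr rfl fun x _ => coeff_mul_congr (fun m hm => (coeff_macMahonU _ hm).symm)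
    fun m hm => ?_
  rw [PowerSeries.coeff_smul, coeff_powerSum _ hm, smul_eq_mul, ← PowerSeries.coeff_C_mul]
  simp

theorem succ_mul_macMahonUStar_succ (t : ℕ) :
    ((t : ℂ) + 1) • macMahonUStar (t + 1) = ∑ x ∈ Finset.HasAntidiagonal.antidiagonal t,
      macMahonUStar x.1 * powerSum x.2 := by
  ext n
  have h := congrArg (PowerSeries.coeff n) (succ_mul_complSum_succ factor n t)
  rw [show (t : ℂ⟦X⟧) + 1 = PowerSeries.C ((t : ℂ) + 1) by simp, PowerSeries.coeff_C_mul] at h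
  rw [PowerSeries.coeff_smul, smul_eq_mul, coeff_macMahonUStar _ le_rfl, h, map_sum, map_sum]
  exact Finset.sum_congr rfl fun x _ => coeff_mul_congr
    (fun m hm => (coeff_macMahonUStar _ hm).symm) fun m hm => (coeff_powerSum _ hm).symm

theorem macMahonU_zero : macMahonU 0 = 1 := by
  ext n
  rw [coeff_macMahonU _ le_rfl, elemSum_zero_right]

theorem macMahonUStar_zero : macMahonUStar 0 = 1 := by
  ext n
  rw [coeff_macMahonUStar _ le_rfl, complSum_zero_right]

/-- The polynomial `∏_{j=1}^m (Y - j²) / (2m+1)!`. -/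
def binomPoly : ℕ → Polynomial ℂ
  | 0 => 1
  | m + 1 => binomPoly m * ((Polynomial.X - Polynomial.C (((m : ℂ) + 1) ^ 2)) *
      Polynomial.C (1 / ((2 * (m : ℂ) + 2) * (2 * m + 3))))

theorem choose_step (n m : ℕ) : ((n + (m + 1)).choose (2 * (m + 1) + 1) : ℂ) *
    ((2 * m + 2) * (2 * m + 3)) =
      (n + m).choose (2 * m + 1) * ((n : ℂ) ^ 2 - ((m : ℂ) + 1) ^ 2) := by
  rcases le_or_gt n m with h | h
  · rw [Nat.choose_eq_zero_of_lt (by lia), Nat.choose_eq_zero_of_lt (by lia)]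
    simp
  obtain ⟨r, rfl⟩ := Nat.exists_eq_add_of_lt h
  have h1 := Nat.add_one_mul_choose_eq (m + r + 1 + m) (2 * m + 2)
  have h2 := Nat.choose_succ_right_eq (m + r + 1 + m) (2 * m + 1)
  rw [show m + r + 1 + m - (2 * m + 1) = r by lia] at h2
  have h1' := congrArg (Nat.cast (R := ℂ)) h1
  have h2' := congrArg (Nat.cast (R := ℂ)) h2
  push_cast at h1' h2' ⊢
  rw [show m + r + 1 + (m + 1) = m + r + 1 + m + 1 by ring,
    show 2 * (m + 1) + 1 = 2 * m + 2 + 1 by ring]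
  rw [show 2 * m + 1 + 1 = 2 * m + 2 by ring] at h2'
  linear_combination (-(2 * (m : ℂ) + 2)) * h1' + (2 * (m : ℂ) + r + 2) * h2'

theorem choose_eq_binomPoly (n m : ℕ) :
    ((n + m).choose (2 * m + 1) : ℂ) = n * (binomPoly m).eval ((n : ℂ) ^ 2) := by
  induction m with
  | zero => simp [binomPoly]
  | succ m ih =>
    have h := choose_step n m
    rw [ih] at h
    have h1 : (2 * (m : ℂ) + 2) ≠ 0 := by exact_mod_cast (2 * m + 1).succ_ne_zero
    have h2 : (2 * (m : ℂ) + 3) ≠ 0 := by exact_mod_cast (2 * m + 2).succ_ne_zero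
    simp only [binomPoly, Polynomial.eval_mul, Polynomial.eval_sub, Polynomial.eval_X,
      Polynomial.eval_C]
    have hd : 1 / ((2 * (m : ℂ) + 2) * (2 * m + 3)) * ((2 * m + 2) * (2 * m + 3)) = 1 :=
      one_div_mul_cancel (mul_ne_zero h1 h2)
    generalize 1 / ((2 * (m : ℂ) + 2) * (2 * m + 3)) = d at *
    linear_combination d * h - ((n + (m + 1)).choose (2 * (m + 1) + 1) : ℂ) * hd

/-- The constant term is `(-1)^m m!²/(2m+1)!`; this form matches the central binomial coefficient of
the final formula at `j = m + 1`. -/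
theorem binomPoly_coeff_zero (m : ℕ) :
    (binomPoly m).coeff 0 * (((m : ℂ) + 1) * ((2 * (m + 1)).choose (m + 1))) = 2 * (-1) ^ m := by
  induction m with
  | zero => norm_num [binomPoly]
  | succ m ih =>
    have h1 : (2 * (m : ℂ) + 2) ≠ 0 := by exact_mod_cast (2 * m + 1).succ_ne_zero
    have h2 : (2 * (m : ℂ) + 3) ≠ 0 := by exact_mod_cast (2 * m + 2).succ_ne_zero
    have h3 := congrArg (Nat.cast (R := ℂ)) (Nat.succ_mul_centralBinom_succ (m + 1))
    simp only [Nat.centralBinom] at h3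
    rw [Polynomial.coeff_zero_eq_eval_zero] at ih ⊢
    simp only [binomPoly, Polynomial.eval_mul, Polynomial.eval_sub, Polynomial.eval_X,
      Polynomial.eval_C]
    push_cast at h3 ⊢
    rw [pow_succ (-1 : ℂ), mul_neg_one]
    generalize (((2 * (m + 1 + 1)).choose (m + 1 + 1) : ℕ) : ℂ) = A at *
    generalize (((2 * (m + 1)).choose (m + 1) : ℕ) : ℂ) = B at *
    generalize Polynomial.eval 0 (binomPoly m) = e at *
    have hd : 1 / ((2 * (m : ℂ) + 2) * (2 * m + 3)) * ((2 * m + 2) * (2 * m + 3)) = 1 :=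
      one_div_mul_cancel (mul_ne_zero h1 h2)
    generalize 1 / ((2 * (m : ℂ) + 2) * (2 * m + 3)) = d at *
    linear_combination (-e * ((m : ℂ) + 1) ^ 2 * d) * h3 -
      (d * ((2 * m + 2) * (2 * m + 3))) * ih - 2 * (-1) ^ m * hd

theorem cast_choose_ne_zero (m : ℕ) : ((2 * (m + 1)).choose (m + 1) : ℂ) ≠ 0 :=
  Nat.cast_ne_zero.2 (Nat.centralBinom_ne_zero (m + 1))

theorem binomPoly_coeff_zero_eq (m : ℕ) : (binomPoly m).coeff 0 =
    2 * (-1) ^ m / (((m : ℂ) + 1) * ((2 * (m + 1)).choose (m + 1))) := by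
  rw [eq_div_iff, binomPoly_coeff_zero]
  exact mul_ne_zero (by exact_mod_cast m.succ_ne_zero) (cast_choose_ne_zero m)

theorem powerSum_eq_sum_sigmaSeries (m : ℕ) : powerSum m =
    ∑ j ∈ Finset.range ((binomPoly m).natDegree + 1), (binomPoly m).coeff j • sigmaSeries (j + 1) := by
  ext n
  simp only [powerSum, sigmaSeries, map_sum, PowerSeries.coeff_smul, PowerSeries.coeff_mk,
    ArithmeticFunction.sigma_apply, Nat.cast_sum, smul_eq_mul, Finset.mul_sum]
  rw [Finset.sum_comm]
  refine Finset.sum_congr rfl fun d _ => ?_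
  rw [choose_eq_binomPoly, Polynomial.eval_eq_sum_range, Finset.mul_sum]
  refine Finset.sum_congr rfl fun j _ => ?_
  rw [show 2 * (j + 1) - 1 = 2 * j + 1 by lia]
  push_cast
  ring

/-! ### Derivatives of the power sums and of the MacMahon series -/

theorem isPartialE2_powerSum (m : ℕ) :
    IsPartialE2 (powerSum m) (algebraMap ℂ ℂ⟦X⟧ ((binomPoly m).coeff 0 * (-1 / 24))) := by
  rw [powerSum_eq_sum_sigmaSeries]
  have h := IsPartialE2.sum (Finset.range ((binomPoly m).natDegree + 1))
    (f := fun j => (binomPoly m).coeff j • sigmaSeries (j + 1))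
    (g := fun j => if j = 0 then algebraMap ℂ ℂ⟦X⟧ ((binomPoly m).coeff 0 * (-1 / 24)) else 0)
    (fun j _ => by
      split_ifs with hj
      · subst hj
        convert isPartialE2_sigmaSeries_one.smul ((binomPoly m).coeff 0) using 1
        rw [map_mul, Algebra.smul_def]
      · simpa using (isPartialE2_sigmaSeries (k := j + 1) (by lia)).smul ((binomPoly m).coeff j))
  simpa using h

/-- With `∂A = B'`, applying `∂` to `U' = U·A` gives `(∂U)' = ∂U·A + U·B'`. The series `U·B`
satisfies the same equation with the same initial value 0, and the induction on `t` compares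
coefficients. -/
theorem isPartialE2_of_newton {U a : ℕ → ℂ⟦X⟧} {b : ℕ → ℂ} (h0 : U 0 = 1)
    (hU : ∀ t : ℕ, ((t : ℂ) + 1) • U (t + 1) =
      ∑ x ∈ Finset.HasAntidiagonal.antidiagonal t, U x.1 * a x.2)
    (ha : ∀ j : ℕ, IsPartialE2 (a j) (algebraMap ℂ ℂ⟦X⟧ ((j + 1) * b (j + 1)))) (t : ℕ) :
    IsPartialE2 (U t) (∑ j ∈ Finset.Icc 1 t, b j • U (t - j)) := by
  -- The constant term is set to 0 whatever `b 0` is, in agreement with `∂(U 0) = ∂1 = 0`.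
  set B : ℂ⟦X⟧⟦X⟧ := PowerSeries.mk fun j => if j = 0 then 0 else algebraMap ℂ ℂ⟦X⟧ (b j) with hB
  have hUd : PowerSeries.derivative ℂ⟦X⟧ (PowerSeries.mk U) =
      PowerSeries.mk U * PowerSeries.mk a := by
    refine PowerSeries.ext fun t => ?_
    rw [PowerSeries.coeff_derivative, PowerSeries.coeff_mul]
    simp only [PowerSeries.coeff_mk]
    rw [← hU t, Algebra.smul_def, mul_comm]
    simp
  have hBd (j : ℕ) : (PowerSeries.derivative ℂ⟦X⟧ B).coeff j =
      algebraMap ℂ ℂ⟦X⟧ ((j + 1) * b (j + 1)) := by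
    rw [PowerSeries.coeff_derivative, hB, PowerSeries.coeff_mk, if_neg j.succ_ne_zero, mul_comm]
    simp
  have key (t : ℕ) : IsPartialE2 (U t) ((PowerSeries.mk U * B).coeff t) := by
    induction t using Nat.strong_induction_on with
    | h t ih =>
    rcases t with _ | t
    · rw [h0]
      simpa [hB] using IsPartialE2.const 1
    · have h1 := IsPartialE2.sum (Finset.HasAntidiagonal.antidiagonal t) fun x hx =>
        (ih x.1 (by have := Finset.HasAntidiagonal.mem_antidiagonal.1 hx; lia)).mul (ha x.2)
      have hne : ((t : ℂ) + 1) ≠ 0 := by exact_mod_cast t.succ_ne_zero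
      rw [← hU t] at h1
      have h2 := h1.smul ((t : ℂ) + 1)⁻¹
      rw [inv_smul_smul₀ hne] at h2
      have h3 := congrArg (PowerSeries.coeff t)
        (derivative_mul (PowerSeries.mk U) B)
      rw [PowerSeries.coeff_derivative, hUd, ← mul_assoc, map_add,
        PowerSeries.coeff_mul t (PowerSeries.mk U), mul_comm B,
        PowerSeries.coeff_mul t (PowerSeries.mk U * B)] at h3
      simp only [hBd, PowerSeries.coeff_mk] at h3
      rwa [Finset.sum_add_distrib, add_comm (Finset.sum _ _), ← h3, mul_comm,
        show (t : ℂ⟦X⟧) + 1 = PowerSeries.C ((t : ℂ) + 1) by simp, ← PowerSeries.smul_eq_C_mul,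
        inv_smul_smul₀ hne] at h2
  convert key t using 1
  rw [mul_comm, PowerSeries.coeff_mul, Finset.Nat.sum_antidiagonal_eq_sum_range_succ_mk,
    Finset.range_eq_Ico, Finset.sum_eq_sum_Ico_succ_bot t.succ_pos]
  simp only [hB, PowerSeries.coeff_mk, if_true, zero_mul, zero_add]
  refine Finset.sum_congr rfl fun j hj => ?_
  have := Finset.mem_Icc.1 hj
  rw [if_neg (by lia), Algebra.smul_def]

theorem isPartialE2_macMahonU (t : ℕ) : IsPartialE2 (macMahonU t)
    (∑ j ∈ Finset.Icc 1 t,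
      (-(1 / 12) * (1 / ((j : ℂ) ^ 2 * ((2 * j).choose j : ℂ)))) • macMahonU (t - j)) := by
  refine isPartialE2_of_newton (U := macMahonU) (a := fun j => (-1 : ℂ) ^ j • powerSum j)
    (b := fun j => -(1 / 12) * (1 / ((j : ℂ) ^ 2 * ((2 * j).choose j : ℂ))))
    macMahonU_zero succ_mul_macMahonU_succ (fun j => ?_) t
  convert (isPartialE2_powerSum j).smul ((-1) ^ j) using 1
  rw [Algebra.smul_def, ← map_mul, binomPoly_coeff_zero_eq]
  congr 1
  push_cast
  -- The sign in Newton's identity cancels that of the constant term of `binomPoly j`; for `𝒰⋆`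
  -- there is no such cancellation and the sign alternates.
  have h : (-1 : ℂ) ^ j * (-1) ^ j = 1 := by rw [← mul_pow]; simp
  have h1 := cast_choose_ne_zero j
  have h2 : (j : ℂ) + 1 ≠ 0 := by exact_mod_cast j.succ_ne_zero
  field_simp
  linear_combination 24 * h

theorem isPartialE2_macMahonUStar (t : ℕ) : IsPartialE2 (macMahonUStar t)
    (∑ j ∈ Finset.Icc 1 t,
      (1 / 12 * ((-1) ^ j / ((j : ℂ) ^ 2 * ((2 * j).choose j : ℂ)))) • macMahonUStar (t - j)) := by
  refine isPartialE2_of_newton (U := macMahonUStar) (a := powerSum)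
    (b := fun j => 1 / 12 * ((-1) ^ j / ((j : ℂ) ^ 2 * ((2 * j).choose j : ℂ))))
    macMahonUStar_zero succ_mul_macMahonUStar_succ (fun j => ?_) t
  convert isPartialE2_powerSum j using 2
  rw [binomPoly_coeff_zero_eq, pow_succ]
  push_cast
  have h1 := cast_choose_ne_zero j
  have h2 : (j : ℂ) + 1 ≠ 0 := by exact_mod_cast j.succ_ne_zero
  field_simp
  ring

end

end MacMahonQM

theorem proposition4p3 :
    ∃ (hE : AlgebraicIndependent ℂ MacMahonQM.gens)
      (hU : ∀ t : ℕ, MacMahonQM.macMahonU t ∈ MacMahonQM.quasimodularRing)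
      (hV : ∀ t : ℕ, MacMahonQM.macMahonUStar t ∈ MacMahonQM.quasimodularRing),
      ∀ t : ℕ,
        MacMahonQM.partialE2 hE ⟨MacMahonQM.macMahonU t, hU t⟩ =
            (-(1 / 12) : ℂ) • ∑ j ∈ Finset.Icc 1 t,
              (1 / ((j : ℂ) ^ 2 * ((2 * j).choose j : ℂ))) •
                (⟨MacMahonQM.macMahonU (t - j), hU (t - j)⟩ : MacMahonQM.quasimodularRing) ∧
        MacMahonQM.partialE2 hE ⟨MacMahonQM.macMahonUStar t, hV t⟩ =
            (1 / 12 : ℂ) • ∑ j ∈ Finset.Icc 1 t,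
              ((-1) ^ j / ((j : ℂ) ^ 2 * ((2 * j).choose j : ℂ))) •
                (⟨MacMahonQM.macMahonUStar (t - j), hV (t - j)⟩ :
                  MacMahonQM.quasimodularRing) := by
  refine ⟨MacMahonQM.algebraicIndependent_gens,
    fun t => (MacMahonQM.isPartialE2_macMahonU t).mem,
    fun t => (MacMahonQM.isPartialE2_macMahonUStar t).mem, fun t => ⟨?_, ?_⟩⟩
  · apply Subtype.ext
    rw [(MacMahonQM.isPartialE2_macMahonU t).partialE2_eq]
    simp [Finset.smul_sum, smul_smul]
  · apply Subtype.ext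
    rw [(MacMahonQM.isPartialE2_macMahonUStar t).partialE2_eq]
    simp [Finset.smul_sum, smul_smul]
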